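/- **Theorem 1.4.** Let $\mathrm{Gp}_\omega$ be the standard Borel space of all groups with domain $\omega=\mathbb{N}$ (group operations regarded as points of the product space $\omega^{\omega\times\omega}$), and let $\mathrm{TFAB}_\omega\subseteq\mathrm{Gp}_\omega$ be the Borel subspace of torsion-free abelian groups with domain $\omega$. A group is *Hopfian* if each of its surjective endomorphisms is injective. A subset $A$ of a standard Borel space $X$ is *complete co-analytic* if $A$ is co-analytic and for every standard Borel space $Y$ and every co-analytic $B\subseteq Y$ there is a Borel map $f:Y\to X$ with $B=f^{-1}(A)$. Then: 1. The set of Hopfian groups in $\mathrm{TFAB}_\omega$ is complete co-analytic in $\mathrm{TFAB}_\omega$. 2. There is a Borel map $T\mapsto G_1[T]$ from the space of trees with domain $\omega$ (strict partial orders on $\omega$ in which the predecessors of each element form a finite chain, regarded as points of $2^{\omega\times\omega}$) to $\mathrm{TFAB}_\omega$ such that, for every such tree $T$, $T$ has an infinite branch (an infinite maximal chain) if and only if $G_1[T]$ is not Hopfian. 3. The set of Hopfian groups in $\mathrm{Gp}_\omega$ is complete co-analytic in $\mathrm{Gp}_\omega$. -/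

import Mathlib

universe u v

/-! ### Co-analytic and complete co-analytic subsets of standard Borel spaces -/

/-- A subset of a standard Borel space is co-analytic if its complement is analytic (with respect to
a Polish topology generating the Borel structure; the choice of that topology is immaterial). -/
def IsCoanalytic {X : Type u} [MeasurableSpace X] [StandardBorelSpace X] (A : Set X) : Prop :=
  ∃ τ : TopologicalSpace X, @PolishSpace X τ ∧ BorelSpace X ∧ MeasureTheory.AnalyticSet Aᶜ

/-- A subset `A` of a standard Borel space is complete co-analytic if it is co-analytic and every
co-analytic subset `B` of every standard Borel space `Y` is the preimage of `A` under a Borel map. -/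
def IsCompleteCoanalytic {X : Type u} [MeasurableSpace X] [StandardBorelSpace X] (A : Set X) :
    Prop :=
  IsCoanalytic A ∧
    ∀ (Y : Type v) [MeasurableSpace Y] [StandardBorelSpace Y] (B : Set Y), IsCoanalytic B →
      ∃ f : Y → X, Measurable f ∧ ∀ y, y ∈ B ↔ f y ∈ A

/-! ### Groups with domain `ω` -/

/-- A group is Hopfian if every surjective endomorphism is injective. -/
def IsHopfian (G : Type u) [Group G] : Prop :=
  ∀ f : G →* G, Function.Surjective f → Function.Injective f

/-- The binary operation `m` on `ω = ℕ` satisfies the group axioms. -/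
def IsGroupOp (m : ℕ → ℕ → ℕ) : Prop :=
  (∀ a b c, m (m a b) c = m a (m b c)) ∧
    ∃ e, (∀ a, m e a = a ∧ m a e = a) ∧ ∀ a, ∃ b, m b a = e ∧ m a b = e

/-- `Gp_ω`: the space of all groups with domain `ω`, as a subspace of the space `ω → ω → ω` of all
binary operations (product Borel structure). -/
abbrev GpOmega : Type := {m : ℕ → ℕ → ℕ // IsGroupOp m}

/-- The underlying set of a group with domain `ω`. This is always `ℕ`; the type synonym carries
the group operation `G`, not the usual arithmetic of `ℕ`. -/
def GpOmega.Carrier (_G : GpOmega) : Type := ℕ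

noncomputable instance GpOmega.instGroup (G : GpOmega) : Group G.Carrier where
  mul := G.1
  mul_assoc := G.2.1
  one := G.2.2.choose
  one_mul a := (G.2.2.choose_spec.1 a).1
  mul_one a := (G.2.2.choose_spec.1 a).2
  inv a := (G.2.2.choose_spec.2 a).choose
  inv_mul_cancel a := (G.2.2.choose_spec.2 a).choose_spec.1

/-- The set of torsion-free abelian groups with domain `ω` (written multiplicatively). -/
def tfabSet : Set GpOmega :=
  {G | (∀ a b : G.Carrier, a * b = b * a) ∧ ∀ a : G.Carrier, a ≠ 1 → ¬ IsOfFinOrder a}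

/-- `TFAB_ω`: the space of torsion-free abelian groups with domain `ω`, as a subspace of `Gp_ω`. -/
abbrev TFABOmega : Type := {G : GpOmega // G ∈ tfabSet}

/-! ### `Gp_ω` and `TFAB_ω` are standard Borel spaces -/

theorem measurable_op_comp {α : Type*} [MeasurableSpace α] {m : α → ℕ → ℕ → ℕ}
    (hm : Measurable m) {f g : α → ℕ} (hf : Measurable f) (hg : Measurable g) :
    Measurable fun x => m x (f x) (g x) := by
  have h : Measurable fun p : α × (ℕ × ℕ) => m p.1 p.2.1 p.2.2 :=
    measurable_from_prod_countable_left fun p =>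
      (measurable_pi_apply p.2).comp ((measurable_pi_apply p.1).comp hm)
  exact h.comp (measurable_id.prodMk (hf.prodMk hg))

theorem measurableSet_isGroupOp : MeasurableSet {m : ℕ → ℕ → ℕ | IsGroupOp m} := by
  have hop : ∀ {f g : (ℕ → ℕ → ℕ) → ℕ}, Measurable f → Measurable g →
      Measurable fun m : ℕ → ℕ → ℕ => m (f m) (g m) :=
    fun hf hg => measurable_op_comp measurable_id hf hg
  have heq : ∀ {f g : (ℕ → ℕ → ℕ) → ℕ}, Measurable f → Measurable g →
      Measurable fun m => f m = g m := fun hf hg => (measurableSet_eq_fun hf hg).mem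
  have hc : ∀ n : ℕ, Measurable fun _ : ℕ → ℕ → ℕ => n := fun _ => measurable_const
  refine Measurable.setOf (Measurable.and ?_ ?_)
  · exact .forall fun a => .forall fun b => .forall fun c =>
      heq (hop (hop (hc a) (hc b)) (hc c)) (hop (hc a) (hop (hc b) (hc c)))
  · exact .exists fun e => .and
      (.forall fun a => .and (heq (hop (hc e) (hc a)) (hc a)) (heq (hop (hc a) (hc e)) (hc a)))
      (.forall fun a => .exists fun b =>
        .and (heq (hop (hc b) (hc a)) (hc e)) (heq (hop (hc a) (hc b)) (hc e)))

instance instStandardBorelSpaceGpOmega : StandardBorelSpace GpOmega :=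
  measurableSet_isGroupOp.standardBorel

/-- The natural number `a`, as an element of the group `G` with domain `ω`. -/
def GpOmega.toCarrier (G : GpOmega) (a : ℕ) : G.Carrier := a

/-- An element of the group `G` with domain `ω`, as a natural number. -/
def GpOmega.toNat (G : GpOmega) (a : G.Carrier) : ℕ := a

theorem measurable_gpOmega_one : Measurable fun G : GpOmega => G.toNat 1 := by
  refine measurable_to_countable' fun k => ?_
  have h : (fun G : GpOmega => G.toNat 1) ⁻¹' {k} = {G | G.1 k k = k} := by
    ext G
    refine ⟨fun h => ?_, fun h => ?_⟩
    · obtain rfl : G.toNat 1 = k := h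
      exact mul_one (1 : G.Carrier)
    · have h' : G.toCarrier k * G.toCarrier k = G.toCarrier k := h
      exact (mul_eq_left.1 h').symm
  rw [h]
  exact measurableSet_eq_fun
    (measurable_op_comp measurable_subtype_coe measurable_const measurable_const) measurable_const

theorem measurable_gpOmega_pow (a n : ℕ) :
    Measurable fun G : GpOmega => G.toNat (G.toCarrier a ^ n) := by
  induction n with
  | zero => simpa only [pow_zero] using measurable_gpOmega_one
  | succ n ih =>
    have h : (fun G : GpOmega => G.toNat (G.toCarrier a ^ (n + 1))) =
        fun G => G.1 (G.toNat (G.toCarrier a ^ n)) a :=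
      funext fun G => congrArg G.toNat (pow_succ (G.toCarrier a) n)
    rw [h]
    exact measurable_op_comp measurable_subtype_coe ih measurable_const

theorem measurableSet_tfabSet : MeasurableSet tfabSet := by
  have hop : ∀ a b : ℕ, Measurable fun G : GpOmega => G.1 a b := fun a b =>
    measurable_op_comp measurable_subtype_coe measurable_const measurable_const
  have h : tfabSet = {G | (∀ a b : ℕ, G.1 a b = G.1 b a) ∧ ∀ a : ℕ, a ≠ G.toNat 1 →
      ¬ ∃ n, 0 < n ∧ G.toNat (G.toCarrier a ^ n) = G.toNat 1} := by
    ext G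
    simp only [tfabSet, isOfFinOrder_iff_pow_eq_one]
    rfl
  rw [h]
  refine Measurable.setOf (Measurable.and ?_ ?_)
  · exact .forall fun a => .forall fun b => (measurableSet_eq_fun (hop a b) (hop b a)).mem
  · exact .forall fun a => .imp
      (.not (measurableSet_eq_fun measurable_const measurable_gpOmega_one).mem)
      (.not (.exists fun n => .and measurable_const
        (measurableSet_eq_fun (measurable_gpOmega_pow a n) measurable_gpOmega_one).mem))

instance instStandardBorelSpaceTFABOmega : StandardBorelSpace TFABOmega :=
  measurableSet_tfabSet.standardBorel

/-! ### Trees with domain `ω` -/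

/-- The strict partial order `r` on `ω` is a tree in which every element has finitely many
predecessors (so that these are well-ordered as soon as they are linearly ordered). There may be
more than one root. -/
def IsTreeRel (r : ℕ → ℕ → Prop) : Prop :=
  (∀ t, ¬ r t t) ∧ (∀ s t w, r s t → r t w → r s w) ∧
    (∀ t s s', r s t → r s' t → s ≠ s' → r s s' ∨ r s' s) ∧ ∀ t, {s | r s t}.Finite

/-- The space of trees with domain `ω`, as a subspace of the space of all binary relations on `ω`
(product Borel structure, `Prop` being discrete). -/
abbrev TreeOmega : Type := {r : ℕ → ℕ → Prop // IsTreeRel r}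

/-- The tree `T` has an infinite branch, a branch being a maximal chain. -/
def TreeOmega.HasInfiniteBranch (T : TreeOmega) : Prop :=
  ∃ b : Set ℕ, IsMaxChain T.1 b ∧ b.Infinite

/-! ### A completely decomposable group attached to a strict order -/

/-! Write `s ≤ t` for `s = t` or `r s t`. The group attached to `r` is the direct sum of rank-one
groups `R_t ⊆ ℚ`, where exactly the primes `p_u` with `u ≤ t` are not inverted. If `s ≰ t`, then
`R_t` is `p_s`-divisible while `R_s` has no nonzero `p_s`-divisible element, so homomorphisms `R_t →
R_s` other than zero need `s ≤ t`: endomorphisms are triangular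
(`exists_support_ge_of_apply_ne_zero`).

If `r` has no infinite ascending sequence, induction from the top shows that a surjective triangular
map has nonzero diagonal entries, hence is injective (`injective_of_surjective_of_wellFounded`).
Along an ascending sequence there is instead room to send basis vectors downward onto all elements
of each summand, with some sent to zero (`exists_surjective_not_injective_of_ascending`).

For a tree, an ascending sequence amounts to an infinite branch, and enumerating the group inside a
fixed countable group makes the construction Borel. Completeness follows because every analytic set
Borel-reduces to trees with an infinite branch (`exists_measurable_treeOmega_of_analyticSet`); the
upper bound holds because a non-Hopfian group is witnessed by a point of Baire space satisfying a
Borel condition. -/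

/-- The `u`-th prime number. -/
noncomputable def nodePrime (u : ℕ) : ℕ := Nat.nth Nat.Prime u

instance nodePrime_fact (u : ℕ) : Fact (nodePrime u).Prime := ⟨Nat.prime_nth_prime u⟩

theorem nodePrime_injective : Function.Injective nodePrime :=
  Nat.nth_injective Nat.infinite_setOfPred_prime

/-- The rationals whose denominator is prime to `nodePrime u` for all `u` weakly below `t`. -/
def nodeRing (r : ℕ → ℕ → Prop) (t : ℕ) : Subring ℚ where
  carrier := {q | ∀ u, u = t ∨ r u t → padicNorm (nodePrime u) q ≤ 1}
  zero_mem' u _ := by simp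
  one_mem' u _ := by simp
  add_mem' ha hb u hu := padicNorm.nonarchimedean.trans (max_le (ha u hu) (hb u hu))
  mul_mem' ha hb u hu := by
    rw [padicNorm.mul]
    exact mul_le_one₀ (ha u hu) (padicNorm.nonneg _) (hb u hu)
  neg_mem' ha u hu := by rw [padicNorm.neg]; exact ha u hu

theorem nodeRing_anti {r : ℕ → ℕ → Prop} (hr : ∀ s t w, r s t → r t w → r s w) {s t : ℕ}
    (h : r s t) : nodeRing r t ≤ nodeRing r s := by
  rintro q hq u (rfl | hu)
  · exact hq _ (.inr h)
  · exact hq _ (.inr (hr _ _ _ hu h))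

/-- The direct sum of the groups `nodeRing r t`, as a subgroup of the rational vector space
with basis `ℕ`. -/
def orderGroup (r : ℕ → ℕ → Prop) : AddSubgroup (ℕ →₀ ℚ) where
  carrier := {g | ∀ t, g t ∈ nodeRing r t}
  zero_mem' t := (nodeRing r t).zero_mem
  add_mem' ha hb t := (nodeRing r t).add_mem (ha t) (hb t)
  neg_mem' ha t := (nodeRing r t).neg_mem (ha t)

theorem single_mem_orderGroup {r : ℕ → ℕ → Prop} {t : ℕ} {q : ℚ} (hq : q ∈ nodeRing r t) :
    Finsupp.single t q ∈ orderGroup r := by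
  intro u
  by_cases h : t = u
  · subst h; simpa using hq
  · simp [Finsupp.single_eq_of_ne' h]

instance orderGroup_infinite (r : ℕ → ℕ → Prop) : Infinite (orderGroup r) := by
  refine Infinite.of_injective
    (fun n : ℕ => (⟨.single n 1, single_mem_orderGroup (nodeRing r n).one_mem⟩ : orderGroup r)) ?_
  intro a b h
  exact Finsupp.single_left_injective one_ne_zero (congrArg Subtype.val h)

/-! #### Ascending sequences -/

theorem rel_of_lt_of_rel_succ {α : Type*} {r : α → α → Prop}
    (hr : ∀ s t w, r s t → r t w → r s w) {M : ℕ → α} (hM : ∀ n, r (M n) (M (n + 1))) :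
    ∀ m n, m < n → r (M m) (M n) := fun m n h => by
  induction n, h using Nat.le_induction with
  | base => exact hM m
  | succ n _ ih => exact hr _ _ _ ih (hM n)

theorem injective_of_rel_of_lt {α : Type*} {r : α → α → Prop} (hi : ∀ t, ¬ r t t) {M : ℕ → α}
    (h : ∀ m n, m < n → r (M m) (M n)) : Function.Injective M :=
  Function.Injective.of_lt_imp_ne fun m n hmn e => hi (M n) (e ▸ h m n hmn)

/-! #### Non-Hopfian if there is an infinite ascending sequence -/

theorem exists_surjective_not_injective_of_ascending {r : ℕ → ℕ → Prop} (hi : ∀ t, ¬ r t t)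
    (hr : ∀ s t w, r s t → r t w → r s w) {M : ℕ → ℕ} (hM : ∀ n, r (M n) (M (n + 1))) :
    ∃ f : orderGroup r →+ orderGroup r, Function.Surjective f ∧ ¬ Function.Injective f := by
  classical
  have hlt := rel_of_lt_of_rel_succ hr hM
  have hinj := injective_of_rel_of_lt hi hlt
  obtain ⟨c, hc⟩ := exists_surjective_nat ℚ
  -- For each `n`, the `q n m` run over all of `R_{M n}`; entries of the enumeration outside it are
  -- replaced by `0`.
  have hcoef : ∀ n m, ∃ q ∈ nodeRing r (M n), c m ∈ nodeRing r (M n) → q = c m := fun n m => by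
    by_cases h : c m ∈ nodeRing r (M n)
    · exact ⟨_, h, fun _ => rfl⟩
    · exact ⟨0, zero_mem _, fun h' => absurd h' h⟩
  choose q hq hqc using hcoef
  let w : ℕ → ℕ →₀ ℚ := fun k => .single (M k.unpair.1) (q k.unpair.1 k.unpair.2)
  let v : ℕ → ℕ →₀ ℚ := Function.extend M w fun t => .single t 1
  have hvM : ∀ k, v (M k) = w k := fun k => hinj.extend_apply _ _ _
  have hvne : ∀ t, (¬ ∃ k, M k = t) → v t = .single t 1 := fun t h =>
    Function.extend_apply' _ _ _ h
  have hsmul : ∀ t, ∀ a ∈ nodeRing r t, a • v t ∈ orderGroup r := fun t a ha => by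
    by_cases h : ∃ k, M k = t
    · obtain ⟨k, rfl⟩ := h
      rw [hvM]
      simp only [w, Finsupp.smul_single, smul_eq_mul]
      refine single_mem_orderGroup (mul_mem ?_ (hq _ _))
      -- The target index `k.unpair.1` is at most `k`, so the map goes down the sequence, where the
      -- coefficient rings grow.
      rcases (Nat.unpair_left_le k).eq_or_lt with h | h
      · rwa [h]
      · exact nodeRing_anti hr (hlt _ _ h) ha
    · rw [hvne t h]
      simpa using single_mem_orderGroup ha
  let F : (ℕ →₀ ℚ) →ₗ[ℚ] (ℕ →₀ ℚ) := Finsupp.linearCombination ℚ v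
  have hF : ∀ g ∈ orderGroup r, F g ∈ orderGroup r := fun g hg => by
    rw [Finsupp.linearCombination_apply, Finsupp.sum]
    exact sum_mem fun t _ => hsmul t _ (hg t)
  have hFs : ∀ t a, F (.single t a) = a • v t := fun t a => Finsupp.linearCombination_single ..
  let f : orderGroup r →+ orderGroup r :=
    (F.toAddMonoidHom.comp (orderGroup r).subtype).codRestrict (orderGroup r) fun g => hF g g.2
  have hf : ∀ g, (f g : ℕ →₀ ℚ) = F g := fun g => rfl
  have hcov : ∀ n, ∀ a ∈ nodeRing r (M n), ∃ k, w k = .single (M n) a := fun n a ha => by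
    obtain ⟨m, rfl⟩ := hc a
    exact ⟨Nat.pair n m, by simp [w, hqc n m ha]⟩
  have hone : ∀ t, Finsupp.single t (1 : ℚ) ∈ orderGroup r := fun t =>
    single_mem_orderGroup (one_mem _)
  refine ⟨f, fun g => ?_, fun h => ?_⟩
  · have hsing : ∀ t, ∀ a ∈ nodeRing r t, ∃ x ∈ orderGroup r, F x = .single t a := by
      intro t a ha
      by_cases h : ∃ k, M k = t
      · obtain ⟨n, rfl⟩ := h
        obtain ⟨k, hk⟩ := hcov n a ha
        exact ⟨.single (M k) 1, hone _, by rw [hFs, hvM, hk, one_smul]⟩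
      · exact ⟨.single t a, single_mem_orderGroup ha, by rw [hFs, hvne t h]; simp⟩
    choose! x hx hxF using hsing
    refine ⟨⟨∑ t ∈ g.1.support, x t (g.1 t), sum_mem fun t _ => hx t _ (g.2 t)⟩, Subtype.ext ?_⟩
    rw [hf, map_sum, Finset.sum_congr rfl fun t _ => hxF t _ (g.2 t)]
    exact Finsupp.sum_single g.1
  · obtain ⟨k, hk⟩ := hcov 0 0 (zero_mem _)
    have h0 : f ⟨_, hone (M k)⟩ = f 0 := Subtype.ext (by
      rw [hf, hf, hFs, hvM, hk]; simp)
    have := congrArg Subtype.val (h h0)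
    simp at this

/-! #### Hopfian if there is no infinite ascending sequence -/

/-- Otherwise no coordinate in the support of `g` is constrained at `p_s`, so `g` is divisible by
every power of `p_s`. Then so is `(f g) s` in `R_s`, which forces it to vanish. -/
theorem exists_support_ge_of_apply_ne_zero {r : ℕ → ℕ → Prop}
    (f : orderGroup r →+ orderGroup r) (g : orderGroup r) {s : ℕ} (h : (f g).1 s ≠ 0) :
    ∃ t, g.1 t ≠ 0 ∧ (s = t ∨ r s t) := by
  by_contra! hg
  set p := nodePrime s
  have hp0 : (p : ℚ) ≠ 0 := by exact_mod_cast (nodePrime_fact s).out.ne_zero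
  have hp1 : (1 : ℚ) < p := by exact_mod_cast (nodePrime_fact s).out.one_lt
  have hdiv : ∀ k : ℕ, ((p : ℚ) ^ k)⁻¹ • g.1 ∈ orderGroup r := fun k t u hu => by
    by_cases ht : g.1 t = 0
    · simp [ht]
    · have hne : u ≠ s := by
        rintro rfl
        exact hu.elim (hg t ht).1 (hg t ht).2
      rw [Finsupp.smul_apply, smul_eq_mul, inv_mul_eq_div, padicNorm.div,
        IsAbsoluteValue.abv_pow (padicNorm _),
        padicNorm.padicNorm_of_prime_of_ne fun e => hne (nodePrime_injective e)]
      simpa using g.2 t u hu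
  have hbound : ∀ k : ℕ, padicNorm p ((f g).1 s) ≤ (p : ℚ)⁻¹ ^ k := fun k => by
    have e : g = p ^ k • (⟨_, hdiv k⟩ : orderGroup r) := Subtype.ext <| by
      ext t
      simp [hp0]
    rw [e, map_nsmul]
    have e' : ((p ^ k • f ⟨_, hdiv k⟩ : orderGroup r) : ℕ →₀ ℚ) s =
      (p : ℚ) ^ k * (f ⟨_, hdiv k⟩).1 s := by simp
    rw [e', padicNorm.mul, IsAbsoluteValue.abv_pow (padicNorm _), padicNorm.padicNorm_p_of_prime]
    exact mul_le_of_le_one_right (by positivity) ((f ⟨_, hdiv k⟩).2 s s (.inl rfl))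
  have hpos : 0 < padicNorm p ((f g).1 s) :=
    (padicNorm.nonneg _).lt_of_ne' (padicNorm.nonzero h)
  obtain ⟨k, hk⟩ := exists_pow_lt_of_lt_one hpos (inv_lt_one_of_one_lt₀ hp1)
  exact (hbound k).not_gt hk

/-- By triangularity only support points weakly above `t` contribute to coordinate `t`, and
maximality leaves just `t` itself. -/
theorem apply_eq_apply_single_of_maximal {r : ℕ → ℕ → Prop}
    (f : orderGroup r →+ orderGroup r) (g : orderGroup r) {t : ℕ}
    (ht : ∀ u, g.1 u ≠ 0 → ¬ r t u) :
    (f g).1 t = (f ⟨.single t (g.1 t), single_mem_orderGroup (g.2 t)⟩).1 t := by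
  set e : orderGroup r := ⟨.single t (g.1 t), single_mem_orderGroup (g.2 t)⟩ with he
  by_contra hne
  have h : (f (g - e)).1 t ≠ 0 := by
    rw [map_sub]
    exact sub_ne_zero.2 hne
  obtain ⟨u, hu, h | h⟩ := exists_support_ge_of_apply_ne_zero f _ h
  · subst h
    simp [he] at hu
  · by_cases htu : t = u
    · subst htu
      simp [he] at hu
    · refine ht u ?_ h
      simpa [he, Finsupp.single_eq_of_ne' htu] using hu

/-- Since `R_t` has rank one, `a` and `b` have a common integer multiple, so vanishing of the
diagonal entry does not depend on the nonzero element tested. -/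
theorem apply_single_eq_zero {r : ℕ → ℕ → Prop} (f : orderGroup r →+ orderGroup r) {t : ℕ}
    {a b : ℚ} (ha : a ∈ nodeRing r t) (hb : b ∈ nodeRing r t) (ha0 : a ≠ 0)
    (h : (f ⟨.single t a, single_mem_orderGroup ha⟩).1 t = 0) :
    (f ⟨.single t b, single_mem_orderGroup hb⟩).1 t = 0 := by
  have e : (b.num * a.den) • (⟨.single t a, single_mem_orderGroup ha⟩ : orderGroup r) =
      (a.num * b.den) • ⟨.single t b, single_mem_orderGroup hb⟩ := Subtype.ext <| by
    have : (b.num * a.den : ℚ) * a = a.num * b.den * b := by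
      linear_combination (b.num : ℚ) * Rat.mul_den_eq_num a - a.num * Rat.mul_den_eq_num b
    simpa using congrArg (Finsupp.single t) this
  have e' := congrArg (fun x : orderGroup r => x.1 t) (congrArg f e)
  simp only [map_zsmul] at e'
  simpa [h, ha0] using e'

theorem exists_maximal_support_ge {r : ℕ → ℕ → Prop} (hi : ∀ t, ¬ r t t)
    (hr : ∀ s t w, r s t → r t w → r s w) (g : ℕ →₀ ℚ) {s : ℕ} (hs : g s ≠ 0) :
    ∃ t, g t ≠ 0 ∧ (s = t ∨ r s t) ∧ ∀ u, g u ≠ 0 → ¬ r t u := by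
  have : IsStrictOrder ℕ (Function.swap r) :=
    { irrefl := hi, trans := fun a b c hab hbc => hr _ _ _ hbc hab }
  have hwf := (g.support.finite_toSet.wellFoundedOn (r := Function.swap r))
  rw [Set.wellFoundedOn_iff] at hwf
  obtain ⟨t, ⟨ht, hst⟩, hmin⟩ := hwf.has_min {t | g t ≠ 0 ∧ (s = t ∨ r s t)} ⟨s, hs, .inl rfl⟩
  refine ⟨t, ht, hst, fun u hu htu => hmin u ⟨hu, .inr ?_⟩ ⟨htu, by simpa using hu, by simpa using ht⟩⟩
  rcases hst with rfl | hst
  · exact htu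
  · exact hr _ _ _ hst htu

theorem injective_of_surjective_of_wellFounded {r : ℕ → ℕ → Prop}
    (hr : ∀ s t w, r s t → r t w → r s w) (hwf : WellFounded (Function.swap r))
    (f : orderGroup r →+ orderGroup r) (hf : Function.Surjective f) : Function.Injective f := by
  have hi : ∀ t, ¬ r t t := fun t h => hwf.irrefl.irrefl t h
  have hdiag : ∀ s a, ∀ ha : a ∈ nodeRing r s, a ≠ 0 →
      (f ⟨.single s a, single_mem_orderGroup ha⟩).1 s ≠ 0 := by
    intro s
    -- The induction hypothesis covers the points strictly above `s`. If the diagonal vanished at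
    -- `s`, take `y` with `f y = e_s` and a maximal support point `t ≥ s` of `y`. Coordinate `t` of
    -- `f y` is then zero if `t = s` and nonzero if `t > s`, the opposite of `e_s`.
    induction s using hwf.induction with
    | _ s ih =>
      intro a ha ha0 h0
      obtain ⟨y, hy⟩ := hf ⟨.single s 1, single_mem_orderGroup (one_mem _)⟩
      obtain ⟨t₀, ht₀, hst₀⟩ := exists_support_ge_of_apply_ne_zero f y (s := s) (by simp [hy])
      obtain ⟨t, ht, hst, hmax⟩ := exists_maximal_support_ge hi hr y.1 ht₀
      have key := apply_eq_apply_single_of_maximal f y hmax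
      have hst' : s = t ∨ r s t := by
        rcases hst₀ with rfl | h
        · exact hst
        · rcases hst with rfl | h'
          · exact .inr h
          · exact .inr (hr _ _ _ h h')
      rcases hst' with rfl | hlt
      · rw [apply_single_eq_zero f ha (y.2 s) ha0 h0, hy] at key
        simp at key
      · have hne : s ≠ t := fun e => hi t (e ▸ hlt)
        refine ih t hlt _ (y.2 t) ht ?_
        rw [← key, hy]
        simp [Finsupp.single_eq_of_ne' hne]
  rw [injective_iff_map_eq_zero]
  intro y hy
  by_contra hne
  obtain ⟨s, hs⟩ : ∃ s, y.1 s ≠ 0 := by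
    by_contra! h
    exact hne (Subtype.ext (Finsupp.ext h))
  obtain ⟨t, ht, -, hmax⟩ := exists_maximal_support_ge hi hr y.1 hs
  refine hdiag t _ (y.2 t) ht ?_
  rw [← apply_eq_apply_single_of_maximal f y hmax, hy]
  rfl

/-! ### Borel coding of subgroups of a countable group by groups with domain `ω` -/

theorem isGroupOp_of_equiv {G : Type*} [Group G] (e : ℕ ≃ G) :
    IsGroupOp fun a b => e.symm (e a * e b) := by
  refine ⟨fun a b c => by simp [mul_assoc], e.symm 1, fun a => by simp,
    fun a => ⟨e.symm (e a)⁻¹, by simp⟩⟩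

/-- The group with domain `ω` obtained by transporting the structure of `G` along a bijection. -/
def GpOmega.ofEquiv {G : Type*} [Group G] (e : ℕ ≃ G) : GpOmega :=
  ⟨fun a b => e.symm (e a * e b), isGroupOp_of_equiv e⟩

/-- The group `GpOmega.ofEquiv e` is isomorphic to `G`. -/
def GpOmega.ofEquivMulEquiv {G : Type*} [Group G] (e : ℕ ≃ G) : (ofEquiv e).Carrier ≃* G :=
  { e with map_mul' := fun a b => e.apply_symm_apply (e a * e b) }

theorem MulEquiv.isHopfian {G H : Type*} [Group G] [Group H] (e : G ≃* H) (h : IsHopfian G) :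
    IsHopfian H := by
  intro f hf
  have := h ((e.symm.toMonoidHom.comp f).comp e.toMonoidHom)
    (e.symm.surjective.comp (hf.comp e.surjective))
  intro a b hab
  have := @this (e.symm a) (e.symm b) (by simp [hab])
  exact e.symm.injective this

theorem ofEquiv_mem_tfabSet {G : Type*} [CommGroup G] [IsMulTorsionFree G] (e : ℕ ≃ G) :
    GpOmega.ofEquiv e ∈ tfabSet := by
  let E := GpOmega.ofEquivMulEquiv e
  refine ⟨fun a b => E.injective (by simp [mul_comm]), fun a ha hfin => ha ?_⟩
  have h : IsOfFinOrder (E a) := E.toMonoidHom.isOfFinOrder hfin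
  exact E.injective (by rw [map_one]; exact (isOfFinOrder_iff_eq_one _).1 h)

/-- The enumeration of an infinite subset of `ℕ`-coded elements. -/
noncomputable def enumEquiv {A : Type*} (c : A ≃ ℕ) (S : Set A) (hS : S.Infinite) : ℕ ≃ S := by
  classical
  have hinf : (Set.ofPred fun n => c.symm n ∈ S).Infinite :=
    hS.preimage (f := c.symm) (by simp)
  exact
    { toFun := fun n => ⟨c.symm (Nat.nth (fun n => c.symm n ∈ S) n), Nat.nth_mem_of_infinite hinf n⟩
      invFun := fun a => Nat.count (fun n => c.symm n ∈ S) (c a)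
      left_inv := fun n => by simp [Nat.count_nth_of_infinite hinf]
      right_inv := fun a => Subtype.ext <| by
        simp [Nat.nth_count (p := fun n => c.symm n ∈ S) (n := c a) (by simp)] }

theorem measurable_count {α : Type*} [MeasurableSpace α] {p : α → ℕ → Prop}
    [∀ x, DecidablePred (p x)] (hp : ∀ n, MeasurableSet {x | p x n}) (n : ℕ) :
    Measurable fun x => Nat.count (p x) n := by
  induction n with
  | zero => simp
  | succ n ih =>
    simp only [Nat.count_succ]
    exact ih.add (.ite (hp n) measurable_const measurable_const)

theorem measurable_nth {α : Type*} [MeasurableSpace α] {p : α → ℕ → Prop}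
    (hp : ∀ n, MeasurableSet {x | p x n}) (hinf : ∀ x, (Set.ofPred (p x)).Infinite) (n : ℕ) :
    Measurable fun x => Nat.nth (p x) n := by
  classical
  refine measurable_to_countable' fun k => ?_
  have h : (fun x => Nat.nth (p x) n) ⁻¹' {k} = {x | p x k} ∩ {x | Nat.count (p x) k = n} := by
    ext x
    constructor
    · rintro rfl
      exact ⟨Nat.nth_mem_of_infinite (hinf x) n, Nat.count_nth_of_infinite (hinf x) n⟩
    · rintro ⟨h, rfl⟩
      exact Nat.nth_count h
  rw [h]
  exact (hp k).inter (measurableSet_eq_fun (measurable_count hp k) measurable_const)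

/-- The coded product of `a` and `b` is found by decoding with `Nat.nth`, multiplying in the fixed
group `A`, and recoding with `Nat.count`; each stage is Borel in the subgroup. -/
theorem measurable_ofEquiv_enumEquiv {α : Type*} [MeasurableSpace α] {A : Type*} [Group A]
    (c : A ≃ ℕ) (H : α → Subgroup A) (hinf : ∀ x, (H x : Set A).Infinite)
    (hH : ∀ a, MeasurableSet {x | a ∈ H x}) :
    Measurable fun x => GpOmega.ofEquiv (G := H x) (enumEquiv c (H x) (hinf x)) := by
  classical
  have hp : ∀ n, MeasurableSet {x | c.symm n ∈ (H x : Set A)} := fun n => hH _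
  have hinf' : ∀ x, (Set.ofPred fun n => c.symm n ∈ (H x : Set A)).Infinite := fun x =>
    (hinf x).preimage (f := c.symm) (by simp)
  refine Measurable.subtype_mk (measurable_pi_lambda _ fun a => measurable_pi_lambda _ fun b => ?_)
  have hn := fun n => measurable_nth hp hinf' n
  have hv : Measurable fun x => c (c.symm (Nat.nth (fun n => c.symm n ∈ (H x : Set A)) a) *
      c.symm (Nat.nth (fun n => c.symm n ∈ (H x : Set A)) b)) :=
    (Measurable.of_discrete (f := fun q : ℕ × ℕ => c (c.symm q.1 * c.symm q.2))).comp
      ((hn a).prodMk (hn b))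
  have hc : Measurable fun q : α × ℕ => Nat.count (fun n => c.symm n ∈ (H q.1 : Set A)) q.2 :=
    measurable_from_prod_countable_left fun n => measurable_count hp n
  exact hc.comp (measurable_id.prodMk hv)

/-! ### The map from trees to torsion-free abelian groups -/

/-- A chain with a maximal element `m` lies in `m` together with its finitely many predecessors, so
an infinite chain has none. Conversely the range of an ascending sequence extends to a maximal
chain. -/
theorem TreeOmega.hasInfiniteBranch_iff (T : TreeOmega) :
    T.HasInfiniteBranch ↔ ¬ WellFounded (Function.swap T.1) := by
  obtain ⟨r, hi, hr, -, hfin⟩ := T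
  constructor
  · rintro ⟨b, hb, hinf⟩ hwf
    obtain ⟨m, hm, hmax⟩ := hwf.has_min b hinf.nonempty
    refine hinf (((hfin m).insert m).subset fun x hx => ?_)
    by_cases hxm : x = m
    · exact .inl hxm
    · exact .inr ((hb.1 hx hm hxm).resolve_right (hmax x hx))
  · intro h
    rw [wellFounded_iff_isEmpty_descending_chain, not_isEmpty_iff] at h
    obtain ⟨M, hM⟩ := h
    have hlt := rel_of_lt_of_rel_succ hr hM
    have hinj := injective_of_rel_of_lt hi hlt
    have hc : IsChain r (Set.range M) := by
      rintro _ ⟨m, rfl⟩ _ ⟨n, rfl⟩ hne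
      rcases lt_trichotomy m n with h | rfl | h
      · exact .inl (hlt _ _ h)
      · exact absurd rfl hne
      · exact .inr (hlt _ _ h)
    obtain ⟨b, hb, hsub⟩ := hc.exists_maxChain
    exact ⟨b, hb, (Set.infinite_range_of_injective hinj).mono hsub⟩

theorem exists_measurable_treeOmega_tfabOmega : ∃ Φ : TreeOmega → TFABOmega, Measurable Φ ∧
    ∀ T : TreeOmega, T.HasInfiniteBranch ↔ ¬ IsHopfian (Φ T).1.Carrier := by
  have : Countable (Multiplicative (ℕ →₀ ℚ)) := inferInstanceAs (Countable (ℕ →₀ ℚ))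
  obtain ⟨hden⟩ := nonempty_denumerable (Multiplicative (ℕ →₀ ℚ))
  let c := Denumerable.eqv (Multiplicative (ℕ →₀ ℚ))
  let H : TreeOmega → Subgroup (Multiplicative (ℕ →₀ ℚ)) := fun T =>
    AddSubgroup.toSubgroup (orderGroup T.1)
  have hinf : ∀ T, (H T : Set (Multiplicative (ℕ →₀ ℚ))).Infinite := fun T =>
    Set.infinite_coe_iff.1 (orderGroup_infinite T.1)
  have hH : ∀ a, MeasurableSet {T | a ∈ H T} := fun a => by
    have hrel : ∀ u t, MeasurableSet {T : TreeOmega | T.1 u t} := fun u t =>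
      ((measurable_pi_apply t).comp ((measurable_pi_apply u).comp measurable_subtype_coe)).setOf
    -- For fixed `a` the norm condition does not involve `T`, which leaves a countable Boolean
    -- combination of the events `T.1 u t`.
    change MeasurableSet {T : TreeOmega | ∀ t u, u = t ∨ T.1 u t →
      padicNorm (nodePrime u) (a.toAdd t) ≤ 1}
    exact Measurable.setOf (.forall fun t => .forall fun u =>
      .imp (.or measurable_const (hrel u t).mem) measurable_const)
  refine ⟨fun T => ⟨.ofEquiv (G := H T) (enumEquiv c (H T) (hinf T)), ofEquiv_mem_tfabSet _⟩,
    (measurable_ofEquiv_enumEquiv c H hinf hH).subtype_mk, fun T => ?_⟩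
  let E := GpOmega.ofEquivMulEquiv (G := H T) (enumEquiv c (H T) (hinf T))
  have hE : IsHopfian (GpOmega.ofEquiv (G := H T) (enumEquiv c (H T) (hinf T))).Carrier ↔
      IsHopfian (Multiplicative (orderGroup T.1)) := ⟨E.isHopfian, E.symm.isHopfian⟩
  rw [T.hasInfiniteBranch_iff, not_iff_not]
  refine Iff.trans ⟨fun hwf f hf => ?_, fun h => ?_⟩ hE.symm
  · exact injective_of_surjective_of_wellFounded T.2.2.1 hwf (AddMonoidHom.toMultiplicative.symm f) hf
  · rw [wellFounded_iff_isEmpty_descending_chain]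
    refine ⟨fun M => ?_⟩
    obtain ⟨f, hf, hf'⟩ :=
      exists_surjective_not_injective_of_ascending T.2.1 T.2.2.1 (M := M.1) M.2
    exact hf' (h (AddMonoidHom.toMultiplicative f) hf)

/-! ### Trees of analytic sets -/

/-- The sequences `x : ℕ → ℕ` having `l` as an initial segment. -/
def listCylinder (l : List ℕ) : Set (ℕ → ℕ) := {x | (List.range l.length).map x = l}

theorem map_range_mem_listCylinder (x : ℕ → ℕ) (n : ℕ) :
    x ∈ listCylinder ((List.range n).map x) := by
  simp [listCylinder]

theorem mem_listCylinder_iff {l : List ℕ} {x : ℕ → ℕ} :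
    x ∈ listCylinder l ↔ ∀ i (h : i < l.length), x i = l[i] := by
  constructor
  · intro h i hi
    have h' : (List.range l.length).map x = l := h
    have := (List.getElem_of_eq h' (i := i) (by simpa using hi))
    simpa using this
  · intro h
    exact List.ext_getElem (by simp) fun i h₁ h₂ => by simpa using h i h₂

theorem listCylinder_anti {l l' : List ℕ} (h : l <+: l') : listCylinder l' ⊆ listCylinder l := by
  intro x hx
  rw [mem_listCylinder_iff] at hx ⊢
  intro i hi
  rw [hx i (hi.trans_le h.length_le), h.getElem hi]

/-- Proper extension of finite sequences, with the longer one in `S`, transported to `ℕ`. -/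
def prefixRel (S : Set (List ℕ)) (a b : ℕ) : Prop :=
  Denumerable.ofNat (List ℕ) a <+: Denumerable.ofNat (List ℕ) b ∧ a ≠ b ∧
    Denumerable.ofNat (List ℕ) b ∈ S

theorem denumerable_ofNat_injective (α : Type*) [Denumerable α] :
    Function.Injective (Denumerable.ofNat α) :=
  (Denumerable.eqv α).symm.injective

/-- Keeping all finite sequences as nodes fixes the domain as `ω`; closure of `S` under prefixes
makes those outside `S` isolated. -/
theorem isTreeRel_prefixRel {S : Set (List ℕ)} (hS : ∀ l l', l <+: l' → l' ∈ S → l ∈ S) :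
    IsTreeRel (prefixRel S) := by
  have hinj := denumerable_ofNat_injective (List ℕ)
  refine ⟨fun t h => h.2.1 rfl, ?_, ?_, fun t => ?_⟩
  · rintro s t w ⟨hst, hne, -⟩ ⟨htw, -, hw⟩
    refine ⟨hst.trans htw, ?_, hw⟩
    rintro rfl
    exact hne (hinj (hst.eq_of_length_le htw.length_le))
  · rintro t s s' ⟨hs, -, ht⟩ ⟨hs', -, -⟩ hne
    exact (List.prefix_or_prefix_of_prefix hs hs').imp
      (fun h => ⟨h, hne, hS _ _ hs' ht⟩) fun h => ⟨h, hne.symm, hS _ _ hs ht⟩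
  · refine Set.Finite.subset (s := (Denumerable.ofNat (List ℕ)) ⁻¹'
      {l | l ∈ (Denumerable.ofNat (List ℕ) t).inits}) ?_ fun s hs => ?_
    · exact (List.finite_toSet _).preimage hinj.injOn
    · exact (List.mem_inits _ _).2 hs.1

theorem not_wellFounded_swap_prefixRel_iff {S : Set (List ℕ)} :
    ¬ WellFounded (Function.swap (prefixRel S)) ↔
      ∃ x : ℕ → ℕ, ∀ n, ∃ m, n ≤ m ∧ (List.range m).map x ∈ S := by
  have hinj := denumerable_ofNat_injective (List ℕ)
  rw [wellFounded_iff_isEmpty_descending_chain, not_isEmpty_iff]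
  constructor
  · rintro ⟨M, hM⟩
    let L : ℕ → List ℕ := fun n => Denumerable.ofNat (List ℕ) (M n)
    have hL : ∀ n, L n <+: L (n + 1) := fun n => (hM n).1
    have hlen : ∀ n, n ≤ (L n).length := fun n => by
      induction n with
      | zero => exact Nat.zero_le _
      | succ n ih =>
        refine Nat.succ_le_of_lt (ih.trans_lt ((hL n).length_le.lt_of_ne fun h => ?_))
        exact (hM n).2.1 (hinj ((hL n).eq_of_length h))
    have hmono : ∀ m n, m ≤ n → L m <+: L n := fun m n h => by
      induction n, h using Nat.le_induction with
      | base => exact List.prefix_rfl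
      | succ n _ ih => exact ih.trans (hL n)
    let x : ℕ → ℕ := fun i => (L (i + 1))[i]'(hlen (i + 1))
    have hx : ∀ n, x ∈ listCylinder (L n) := fun n => by
      rw [mem_listCylinder_iff]
      intro i hi
      rcases le_total n (i + 1) with h | h
      · exact ((hmono _ _ h).getElem hi).symm
      · exact (hmono _ _ h).getElem _
    refine ⟨x, fun n => ⟨(L (n + 1)).length, (Nat.le_succ n).trans (hlen _), ?_⟩⟩
    rw [show (List.range (L (n + 1)).length).map x = L (n + 1) from hx (n + 1)]
    exact (hM n).2.2
  · rintro ⟨x, hx⟩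
    choose m hm hmS using hx
    -- Asking for a length at least `k n + 1` makes the chosen lengths strictly increase.
    let k : ℕ → ℕ := fun n => n.rec (m 0) fun _ i => m (i + 1)
    have hk : ∀ n, k n < k (n + 1) := fun n => hm (k n + 1)
    have hkS : ∀ n, (List.range (k (n + 1))).map x ∈ S := fun n => hmS (k n + 1)
    refine ⟨fun n => Encodable.encode ((List.range (k n)).map x), fun n => ?_⟩
    simp only [Function.swap, prefixRel, Denumerable.ofNat_encode]
    refine ⟨?_, fun h => ?_, hkS n⟩
    · refine List.IsPrefix.map x ?_
      rw [List.prefix_iff_eq_take]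
      simp [List.take_range, (hk n).le]
    · have := congrArg List.length (Encodable.encode_injective h)
      simp [(hk n).ne] at this

/-- If `g x ≠ y`, regularity gives a closed neighbourhood of `g x` missing `y`. By continuity it
contains the image of a small cylinder around `x`, hence also the closure of that image. Using
closures makes the conditions on `y` Borel. -/
theorem mem_range_iff_mem_closure_image_listCylinder {Y : Type*} [TopologicalSpace Y] [T3Space Y]
    {g : (ℕ → ℕ) → Y} (hg : Continuous g) (y : Y) :
    y ∈ Set.range g ↔ ∃ x : ℕ → ℕ, ∀ n, ∃ m, n ≤ m ∧
      y ∈ closure (g '' listCylinder ((List.range m).map x)) := by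
  constructor
  · rintro ⟨x, rfl⟩
    exact ⟨x, fun n => ⟨n, le_rfl,
      subset_closure (Set.mem_image_of_mem g (map_range_mem_listCylinder x n))⟩⟩
  · rintro ⟨x, hx⟩
    refine ⟨x, ?_⟩
    by_contra hne
    obtain ⟨C, hC, hCc, hyC⟩ := exists_mem_nhds_isClosed_subset
      (isOpen_compl_singleton.mem_nhds (show g x ∈ ({y}ᶜ : Set Y) from hne))
    obtain ⟨_, ⟨z, n, rfl⟩, hxz, hsub⟩ := (PiNat.isTopologicalBasis_cylinders
      fun _ : ℕ => ℕ).mem_nhds_iff.1 (hg.continuousAt.preimage_mem_nhds hC)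
    rw [← PiNat.mem_cylinder_iff_eq.1 hxz] at hsub
    obtain ⟨m, hnm, hm⟩ := hx n
    refine hyC (closure_minimal ?_ hCc hm) rfl
    rintro _ ⟨w, hw, rfl⟩
    refine hsub (PiNat.mem_cylinder_iff.2 fun i hi => ?_)
    have := mem_listCylinder_iff.1 hw i (by simpa using hi.trans_le hnm)
    simpa using this

theorem exists_measurable_treeOmega_of_analyticSet {Y : Type*} [MeasurableSpace Y]
    [TopologicalSpace Y] [PolishSpace Y] [BorelSpace Y] {A : Set Y}
    (hA : MeasureTheory.AnalyticSet A) :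
    ∃ Ψ : Y → TreeOmega, Measurable Ψ ∧ ∀ y, y ∈ A ↔ (Ψ y).HasInfiniteBranch := by
  obtain ⟨S, hSm, hS, hAS⟩ : ∃ S : Y → Set (List ℕ), (∀ l, MeasurableSet {y | l ∈ S y}) ∧
      (∀ y l l', l <+: l' → l' ∈ S y → l ∈ S y) ∧
      ∀ y, y ∈ A ↔ ∃ x : ℕ → ℕ, ∀ n, ∃ m, n ≤ m ∧ (List.range m).map x ∈ S y := by
    rw [MeasureTheory.AnalyticSet] at hA
    rcases hA with rfl | ⟨g, hg, rfl⟩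
    · exact ⟨fun _ => ∅, by simp, by simp, fun y => by simp⟩
    · exact ⟨fun y => {l | y ∈ closure (g '' listCylinder l)},
        fun l => isClosed_closure.measurableSet,
        fun y l l' h hl => closure_mono (Set.image_mono (listCylinder_anti h)) hl,
        mem_range_iff_mem_closure_image_listCylinder hg⟩
  refine ⟨fun y => ⟨prefixRel (S y), isTreeRel_prefixRel (hS y)⟩, ?_, fun y => ?_⟩
  · refine Measurable.subtype_mk (measurable_pi_lambda _ fun a => measurable_pi_lambda _ fun b => ?_)
    exact .and measurable_const (.and measurable_const (hSm _).mem)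
  · rw [hAS, TreeOmega.hasInfiniteBranch_iff, not_wellFounded_swap_prefixRel_iff]

/-! ### Hopfian groups form a complete co-analytic set -/

theorem isCoanalytic_isHopfian {X : Type*} [MeasurableSpace X] [StandardBorelSpace X]
    {ι : X → GpOmega} (hι : Measurable ι) : IsCoanalytic {x | IsHopfian (ι x).Carrier} := by
  obtain ⟨τ, hb, hp⟩ := StandardBorelSpace.polish (α := X)
  refine ⟨τ, hp, hb, ?_⟩
  -- The second coordinate codes a surjective, non-injective endomorphism; quantifiers over `ℕ` keep
  -- the condition Borel, so its projection is analytic.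
  have h : {x | IsHopfian (ι x).Carrier}ᶜ = Prod.fst '' {q : X × (ℕ → ℕ) |
      (∀ a b, q.2 ((ι q.1).1 a b) = (ι q.1).1 (q.2 a) (q.2 b)) ∧ (∀ b, ∃ a, q.2 a = b) ∧
        ∃ a b, q.2 a = q.2 b ∧ a ≠ b} := by
    ext x
    constructor
    · intro hx
      simp only [Set.mem_compl_iff, Set.mem_ofPred_eq, IsHopfian, not_forall] at hx
      obtain ⟨f, hf, hf'⟩ := hx
      simp only [Function.Injective, not_forall] at hf'
      obtain ⟨a, b, hab, hne⟩ := hf'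
      exact ⟨(x, f), ⟨map_mul f, hf, a, b, hab, hne⟩, rfl⟩
    · rintro ⟨⟨x, f⟩, ⟨hmul, hsurj, a, b, hab, hne⟩, rfl⟩ hx
      exact hne (hx (MonoidHom.mk' (M := (ι x).Carrier) (G := (ι x).Carrier) f hmul) hsurj hab)
  rw [h]
  refine MeasurableSet.analyticSet_image ?_ measurable_fst
  have hop : ∀ {u v : X × (ℕ → ℕ) → ℕ}, Measurable u → Measurable v →
      Measurable fun q => (ι q.1).1 (u q) (v q) := fun hu hv =>
    measurable_op_comp (measurable_subtype_coe.comp (hι.comp measurable_fst)) hu hv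
  have hev : ∀ a, Measurable fun q : X × (ℕ → ℕ) => q.2 a := fun a =>
    (measurable_pi_apply a).comp measurable_snd
  have heval : ∀ {u : X × (ℕ → ℕ) → ℕ}, Measurable u → Measurable fun q : X × (ℕ → ℕ) => q.2 (u q) := by
    intro u hu
    have h : Measurable fun p : (X × (ℕ → ℕ)) × ℕ => p.1.2 p.2 :=
      measurable_from_prod_countable_left hev
    exact h.comp (measurable_id.prodMk hu)
  refine Measurable.setOf (.and (.forall fun a => .forall fun b => ?_)
    (.and (.forall fun b => .exists fun a => ?_) (.exists fun a => .exists fun b => .and ?_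
      measurable_const)))
  · exact (measurableSet_eq_fun (heval (hop measurable_const measurable_const))
      (hop (hev a) (hev b))).mem
  · exact (measurableSet_eq_fun (hev a) measurable_const).mem
  · exact (measurableSet_eq_fun (hev a) (hev b)).mem

theorem isCompleteCoanalytic_isHopfian {X : Type u} [MeasurableSpace X] [StandardBorelSpace X]
    {ι : X → GpOmega} (hι : Measurable ι) {Φ : TreeOmega → X} (hΦ : Measurable Φ)
    (h : ∀ T : TreeOmega, T.HasInfiniteBranch ↔ ¬ IsHopfian (ι (Φ T)).Carrier) :
    IsCompleteCoanalytic.{u, v} {x | IsHopfian (ι x).Carrier} := by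
  refine ⟨isCoanalytic_isHopfian hι, ?_⟩
  rintro Y _ _ B ⟨τ, hp, hb, hB⟩
  obtain ⟨Ψ, hΨ, hBΨ⟩ := exists_measurable_treeOmega_of_analyticSet hB
  exact ⟨Φ ∘ Ψ, hΦ.comp hΨ, fun y => not_iff_not.1 ((hBΨ y).trans (h (Ψ y)))⟩

theorem theorem1p4 :
    IsCompleteCoanalytic.{0, v} {G : TFABOmega | IsHopfian G.1.Carrier} ∧
      (∃ Φ : TreeOmega → TFABOmega, Measurable Φ ∧
        ∀ T : TreeOmega, T.HasInfiniteBranch ↔ ¬ IsHopfian (Φ T).1.Carrier) ∧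
      IsCompleteCoanalytic.{0, v} {G : GpOmega | IsHopfian G.Carrier} := by
  obtain ⟨Φ, hΦ, h⟩ := exists_measurable_treeOmega_tfabOmega
  exact ⟨isCompleteCoanalytic_isHopfian measurable_subtype_coe hΦ h, ⟨Φ, hΦ, h⟩,
    isCompleteCoanalytic_isHopfian measurable_id (measurable_subtype_coe.comp hΦ) h⟩
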